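/- All graphs are finite and simple, and all representations lie between two parallel lines $L_1$ (above) and $L_2$ (below), with all endpoints on each line pairwise distinct. A \emph{permutation} (resp. \emph{trapezoid}) \emph{graph} is the intersection graph of line segments (resp. trapezoids) between $L_1$ and $L_2$; such a family is a permutation (resp. trapezoid) representation of the graph. \emph{Acyclicity.} Let $P$ be a permutation graph whose $2n$ vertices are partitioned into pairs $\{u_i^1,u_i^2\}$, $1\le i\le n$. A permutation representation $R$ of $P$ orients each edge $xy$ of $P$ from the segment with the smaller angle with $L_2$ to the one with the larger angle. Let $F_R$ be the simple directed graph obtained from this orientation by merging $u_i^1$ and $u_i^2$ into one vertex for every $i$. $P$ is \emph{acyclic with respect to} $\{u_i^1,u_i^2\}_{i=1}^n$ if it has a representation $R$ for which $F_R$ has no directed cycle. A trapezoid graph is \emph{acyclic} if it has a trapezoid representation whose left and right lines, viewed as a permutation representation and paired by trapezoid, have this property. \emph{Components.} For a set $S$ of vertices of a graph $G$ let $N(S)=\bigcup_{v\in S}N(v)\setminus S$. For a vertex $u$ and a connected component $C$ of $G\setminus N[u]$ let $D_u(C)$ be the set of components $C'$ of $G\setminus N[u]$ with $N(C')\subseteq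 N(C)$, and let $D_u^*(C)$ be the set of the other components. Let $\delta_u$ be an arbitrarily chosen component $C$ with $|D_u(C)|$ maximum. If $D_u^*(\delta_u)=\emptyset$, let $\delta_u^*=\emptyset$; otherwise let $\delta_u^*$ be an arbitrarily chosen component $C'\in D_u^*(\delta_u)$ such that $N(C')\subsetneq N(C'')$ for no $C''\in D_u^*(\delta_u)$. \emph{Splitting.} Let $N_1(u)$, $N_2(u)$, $N_{12}(u)$ be the sets of neighbors of $u$ that are adjacent to (some vertex of) $\delta_u$ but not $\delta_u^*$, to $\delta_u^*$ but not $\delta_u$, and to both, respectively. The graph $G^{\#}(u)$ arises from $G$ by deleting $u$ and adding two non-adjacent new vertices $u^1,u^2$, the \emph{derivatives} of $u$, where $u^1$ is adjacent to $N_1(u)\cup N_{12}(u)$ and $u^2$ to $N_2(u)\cup N_{12}(u)$. The same rule is used if $\delta_u^*=\emptyset$. \emph{Algorithm Split-$U$.} Given $G$ and $U=\{u_1,\dots,u_k\}\subseteq V(G)$ (with $k$ distinct vertices, in any order), put $H_0=G$ and $H_i=H_{i-1}^{\#}(u_i)$ for $i=1,\dots,k$, where $\delta_{u_i}$ and $\delta_{u_i}^*$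 are chosen in $H_{i-1}$, and return $G^{\#}(U)=H_k[V(H_k)\setminus(V(G)\setminus U)]$. \textbf{Theorem.} Let $G$ be a trapezoid graph and $U=\{u_1,\dots,u_k\}$ a set of $k$ vertices of $G$ such that, in $G$, $\delta_{u_i}^*\neq\emptyset$ for every $i=1,\dots,k$. Then every step of Algorithm Split-$U$ can be carried out ($H_{i-1}\setminus N[u_i]$ always has a component), and, for all choices made during the algorithm, the returned graph $G^{\#}(U)$ is a permutation graph with $2k$ vertices. Furthermore, if $G$ is an acyclic trapezoid graph, then $G^{\#}(U)$ is acyclic with respect to $\{u_i^1,u_i^2\}_{i=1}^k$, where $u_i^1,u_i^2$ are the derivatives of $u_i$. -/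

import Mathlib

universe u

/-! ### Permutation and trapezoid representations

The two parallel lines are `L₁ = {y = 1}` and `L₂ = {y = 0}` in the plane `ℝ × ℝ`.
All endpoints on each of the two lines are pairwise distinct. -/

/-- A family of line segments between `L₁` and `L₂`; the segment of `w` joins the point
`(top w, 1)` of `L₁` to the point `(bot w, 0)` of `L₂`. -/
structure PermRep (W : Type u) where
  top : W → ℝ
  bot : W → ℝ
  top_injective : Function.Injective top
  bot_injective : Function.Injective bot

/-- The segment of `w`, as a set of points of the plane. -/
def PermRep.line {W : Type u} (R : PermRep W) (w : W) : Set (ℝ × ℝ) :=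
  {p | 0 ≤ p.2 ∧ p.2 ≤ 1 ∧ p.1 = (1 - p.2) * R.bot w + p.2 * R.top w}

/-- The intersection graph of the segments. -/
def PermRep.graph {W : Type u} (R : PermRep W) : SimpleGraph W where
  Adj x y := x ≠ y ∧ (R.line x ∩ R.line y).Nonempty
  symm := ⟨fun _ _ h => ⟨h.1.symm, by rw [Set.inter_comm]; exact h.2⟩⟩
  loopless := ⟨fun _ h => h.1 rfl⟩

/-- The angle in `(0, π)` of the segment of `w` with the line `L₂`: the argument of its upward
direction vector `(top w - bot w, 1)`. -/
noncomputable def PermRep.angle {W : Type u} (R : PermRep W) (w : W) : ℝ :=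
  Complex.arg (Complex.mk (R.top w - R.bot w) 1)

/-- The transitive orientation `Φ_R`: the arc from `x` to `y`. -/
def PermRep.orient {W : Type u} (R : PermRep W) (x y : W) : Prop :=
  R.graph.Adj x y ∧ R.angle x < R.angle y

/-- The arcs of the simple directed graph `F_R` obtained from `Φ_R` by merging all vertices
with the same value of `f` into a single vertex. -/
def PermRep.mergedArc {W : Type u} {I : Type u} (R : PermRep W) (f : W → I) (i j : I) : Prop :=
  i ≠ j ∧ ∃ x y : W, f x = i ∧ f y = j ∧ R.orient x y

/-- `R` is acyclic with respect to the classes of `f`: `F_R` has no directed cycle. -/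
def PermRep.IsAcyclic {W : Type u} {I : Type u} (R : PermRep W) (f : W → I) : Prop :=
  ∀ i : I, ¬ Relation.TransGen (R.mergedArc f) i i

def IsPermutationGraph {W : Type u} (P : SimpleGraph W) : Prop :=
  ∃ R : PermRep W, R.graph = P

/-- `P` is an acyclic permutation graph with respect to the pairs `f ⁻¹' {i}`, `i : I`. -/
def IsAcyclicPermutationGraph {W : Type u} {I : Type u} (P : SimpleGraph W) (f : W → I) : Prop :=
  (∀ i : I, (f ⁻¹' {i}).ncard = 2) ∧ ∃ R : PermRep W, R.graph = P ∧ R.IsAcyclic f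

/-- A family of trapezoids between `L₁` and `L₂`, given by their left lines (index `false`)
and right lines (index `true`). -/
structure TrapezoidRep (V : Type u) where
  /-- the permutation representation `R_P` formed by the left and right lines -/
  lines : PermRep (V × Bool)
  top_lt : ∀ v, lines.top (v, false) < lines.top (v, true)
  bot_lt : ∀ v, lines.bot (v, false) < lines.bot (v, true)

/-- The trapezoid of `v`, as a set of points of the plane. -/
def TrapezoidRep.trapezoid {V : Type u} (R : TrapezoidRep V) (v : V) : Set (ℝ × ℝ) :=
  {p | 0 ≤ p.2 ∧ p.2 ≤ 1 ∧
    (1 - p.2) * R.lines.bot (v, false) + p.2 * R.lines.top (v, false) ≤ p.1 ∧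
    p.1 ≤ (1 - p.2) * R.lines.bot (v, true) + p.2 * R.lines.top (v, true)}

/-- The intersection graph of the trapezoids. -/
def TrapezoidRep.graph {V : Type u} (R : TrapezoidRep V) : SimpleGraph V where
  Adj x y := x ≠ y ∧ (R.trapezoid x ∩ R.trapezoid y).Nonempty
  symm := ⟨fun _ _ h => ⟨h.1.symm, by rw [Set.inter_comm]; exact h.2⟩⟩
  loopless := ⟨fun _ h => h.1 rfl⟩

def IsTrapezoidGraph {V : Type u} (G : SimpleGraph V) : Prop :=
  ∃ R : TrapezoidRep V, R.graph = G

/-- `G` has a trapezoid representation `R` such that `R_P` is acyclic with respect to the pairs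
consisting of the left and the right line of each trapezoid. -/
def IsAcyclicTrapezoidGraph {V : Type u} (G : SimpleGraph V) : Prop :=
  ∃ R : TrapezoidRep V, R.graph = G ∧ R.lines.IsAcyclic Prod.fst

/-! ### Neighborhood domination -/

namespace SplitU

variable {V : Type u}

/-- `N(S)`, the vertices outside `S` with a neighbor in `S`. -/
def nbhd (G : SimpleGraph V) (S : Set V) : Set V :=
  (⋃ v ∈ S, G.neighborSet v) \ S

/-- The vertex sets of the connected components of `G \ N[u]`. -/
def components (G : SimpleGraph V) (u : V) : Set (Set V) :=
  Set.range fun c : (G.induce (insert u (G.neighborSet u))ᶜ).ConnectedComponent =>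
    Subtype.val '' c.supp

/-- The neighborhood domination closure `D_u(C)`. -/
def domClosure (G : SimpleGraph V) (u : V) (C : Set V) : Set (Set V) :=
  {D ∈ components G u | nbhd G D ⊆ nbhd G C}

/-- The closure complement `D_u^*(C)`. -/
def closureCompl (G : SimpleGraph V) (u : V) (C : Set V) : Set (Set V) :=
  components G u \ domClosure G u C

/-- `C` is a master component of `u`. -/
def IsMaster (G : SimpleGraph V) (u : V) (C : Set V) : Prop :=
  C ∈ components G u ∧
    ∀ D ∈ components G u, (domClosure G u D).ncard ≤ (domClosure G u C).ncard

/-- `C` is a maximal component in the set `S` of components. -/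
def IsMaximalComp (G : SimpleGraph V) (S : Set (Set V)) (C : Set V) : Prop :=
  C ∈ S ∧ ∀ D ∈ S, ¬ nbhd G C ⊂ nbhd G D

/-- `(δ, δs)` is an admissible choice of the pair `(δ_u, δ_u^*)`. -/
def IsDelta (G : SimpleGraph V) (u : V) (δ δs : Set V) : Prop :=
  IsMaster G u δ ∧
    (closureCompl G u δ = ∅ → δs = ∅) ∧
    (closureCompl G u δ ≠ ∅ → IsMaximalComp G (closureCompl G u δ) δs)

/-- `x` is adjacent to (some vertex of) `S`. -/
def AdjTo (G : SimpleGraph V) (x : V) (S : Set V) : Prop :=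
  ∃ s ∈ S, G.Adj x s

/-- `N₁(u)`; the sets of neighbors are formed with the choices `δ` of `δ_u` and `δs` of
`δ_u^*`. -/
def N₁ (G : SimpleGraph V) (u : V) (δ δs : Set V) : Set V :=
  {x | G.Adj u x ∧ AdjTo G x δ ∧ ¬ AdjTo G x δs}

/-- `N₂(u)` -/
def N₂ (G : SimpleGraph V) (u : V) (δ δs : Set V) : Set V :=
  {x | G.Adj u x ∧ ¬ AdjTo G x δ ∧ AdjTo G x δs}

/-- `N₁₂(u)` -/
def N₁₂ (G : SimpleGraph V) (u : V) (δ δs : Set V) : Set V :=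
  {x | G.Adj u x ∧ AdjTo G x δ ∧ AdjTo G x δs}

/-- The vertices of the graph obtained by splitting `u`: the old vertices other than `u`, and the
two derivatives `u₁ = inr false` and `u₂ = inr true`. -/
abbrev SplitVert (u : V) : Type _ := {v : V // v ≠ u} ⊕ Bool

/-- The neighbors of the two derivatives of `u`. -/
def derivNbrs (G : SimpleGraph V) (u : V) (δ δs : Set V) : Bool → Set V
  | false => N₁ G u δ δs ∪ N₁₂ G u δ δs
  | true => N₂ G u δ δs ∪ N₁₂ G u δ δs

def splitAdj (G : SimpleGraph V) (u : V) (δ δs : Set V) : SplitVert u → SplitVert u → Prop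
  | Sum.inl a, Sum.inl b => G.Adj a.1 b.1
  | Sum.inl a, Sum.inr i => a.1 ∈ derivNbrs G u δ δs i
  | Sum.inr i, Sum.inl a => a.1 ∈ derivNbrs G u δ δs i
  | Sum.inr _, Sum.inr _ => False

/-- The graph `G^#(u)` obtained by the vertex splitting of `u`, for the choice `(δ, δs)`
of `(δ_u, δ_u^*)`. -/
def splitGraph (G : SimpleGraph V) (u : V) (δ δs : Set V) : SimpleGraph (SplitVert u) where
  Adj := splitAdj G u δ δs
  symm := ⟨by
    rintro (a | i) (b | j) h
    · exact SimpleGraph.Adj.symm h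
    · exact h
    · exact h
    · exact h⟩
  loopless := ⟨by
    rintro (a | i) h
    · exact G.loopless.irrefl _ h
    · exact h⟩

/-- The vertex of `G` from which a vertex of the split graph stems, given this information (`π`)
for the graph before the splitting. -/
def splitOrigin {W : Type u} (π : W → V) (w : W) : SplitVert w → V
  | Sum.inl a => π a.1
  | Sum.inr _ => π w

/-- `Reaches G x i W H π`: some run of the loop of Algorithm Split-`U`, with input `G` and
`U = {x 0, …, x (k-1)}`, has `H` as its graph `H_i`. The vertex set of `H` is `W`, and
`π : W → V` maps a vertex of `G` that has not been split to itself and both derivatives of a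
split vertex to that vertex. The choice of `(δ, δ^*)` is made anew, in the current graph, at each
step. -/
inductive Reaches (G : SimpleGraph V) {k : ℕ} (x : Fin k → V) :
    ℕ → (W : Type u) → SimpleGraph W → (W → V) → Prop
  | init : Reaches G x 0 V G id
  | step (i : Fin k) (W : Type u) (H : SimpleGraph W) (π : W → V) (w : W) (δ δs : Set W) :
      Reaches G x i W H π → π w = x i → IsDelta H w δ δs →
      Reaches G x (i + 1) (SplitVert w) (splitGraph H w δ δs) (splitOrigin π w)

/-- The vertices that remain when all unsplit vertices are removed from `H_k`. -/
abbrev FinalVert {k : ℕ} (x : Fin k → V) {W : Type u} (π : W → V) : Set W :=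
  {w | π w ∈ Set.range x}

/-- The returned graph `G^#(U)`. -/
abbrev finalGraph {k : ℕ} (x : Fin k → V) {W : Type u} (H : SimpleGraph W) (π : W → V) :
    SimpleGraph (FinalVert x π) :=
  H.induce (FinalVert x π)

/-- The map sending both derivatives of a vertex of `U` to that vertex. -/
def derivativeOf {k : ℕ} (x : Fin k → V) {W : Type u} (π : W → V) (w : FinalVert x π) :
    Set.range x :=
  ⟨π w.1, w.2⟩

end SplitU

/-! In a representation of $H$, every component of $H\setminus N[u]$ lies wholly to the left or
wholly to the right of $u$. On the left, all components have their neighborhoods inside the set of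
neighbors of $u$ that see something to the left of $u$, and the component reaching furthest right
attains this set; the right side is symmetric. So domination alone recovers the two sides:
$N(\delta_u)$ is the full left or the full right set, and $\delta_u^*$ is empty or yields the other
one (`Represents.nbhd_eq_of_isDelta`).

A derivative can therefore be drawn as a line slightly to the left or right of $u$ that meets
exactly its prescribed neighbors (`Represents.exists_left_line`), or as a far away line if it has no
neighbors. Replacing trapezoids by such lines one vertex at a time keeps a representation; after all
of $U$ is split, the derivatives are represented by segments.

For acyclicity, the invariant `IsSplitRep` also remembers, for each derivative with a neighbor, the
side of its original trapezoid on which its line lies, and that its neighbors stem from vertices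
adjacent to an original trapezoid beyond that line. This forces suitable sides of two original
trapezoids to cross in the same direction as the derivative lines (`IsSplitRep.mergedArc`). Hence a
directed cycle among derivatives would be one among the original trapezoids. -/

/-! ### Combinatorial trapezoids -/

/-- A possibly degenerate trapezoid between the two lines, given by its four corners. -/
structure Trap where
  lt : ℝ
  rt : ℝ
  lb : ℝ
  rb : ℝ
  top_le : lt ≤ rt
  bot_le : lb ≤ rb

namespace Trap

/-- `A` lies strictly to the left of `B`. -/
def Before (A B : Trap) : Prop := A.rt < B.lt ∧ A.rb < B.lb

/-- `A` and `B` intersect. -/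
def Meets (A B : Trap) : Prop := ¬ A.Before B ∧ ¬ B.Before A

/-- The degenerate trapezoid consisting of a single segment. -/
def ofLine (a b : ℝ) : Trap := ⟨a, a, b, b, le_rfl, le_rfl⟩

/-- The mirror image of a trapezoid. -/
def reflect (A : Trap) : Trap :=
  ⟨-A.rt, -A.lt, -A.rb, -A.lb, neg_le_neg A.top_le, neg_le_neg A.bot_le⟩

theorem Before.trans {A B C : Trap} (h : A.Before B) (h' : B.Before C) : A.Before C :=
  ⟨h.1.trans_le (B.top_le.trans h'.1.le), h.2.trans_le (B.bot_le.trans h'.2.le)⟩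

theorem Before.irrefl {A : Trap} (h : A.Before A) : False :=
  absurd (h.1.trans_le A.top_le) (lt_irrefl _)

theorem Meets.symm {A B : Trap} (h : A.Meets B) : B.Meets A := ⟨h.2, h.1⟩

theorem meets_comm {A B : Trap} : A.Meets B ↔ B.Meets A := ⟨Meets.symm, Meets.symm⟩

@[simp] theorem reflect_before {A B : Trap} : A.reflect.Before B.reflect ↔ B.Before A := by
  simp [Before, reflect]

@[simp] theorem reflect_meets {A B : Trap} : A.reflect.Meets B.reflect ↔ A.Meets B := by
  simp [Meets, and_comm]

theorem ofLine_reflect (a b : ℝ) : (ofLine a b).reflect = ofLine (-a) (-b) := rfl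

/-- The points of a trapezoid between the lines `y = 0` and `y = 1`. -/
def points (A : Trap) : Set (ℝ × ℝ) :=
  {p | 0 ≤ p.2 ∧ p.2 ≤ 1 ∧ (1 - p.2) * A.lb + p.2 * A.lt ≤ p.1 ∧
    p.1 ≤ (1 - p.2) * A.rb + p.2 * A.rt}

theorem not_before_of_mem {A B : Trap} {p : ℝ × ℝ} (hA : p ∈ A.points) (hB : p ∈ B.points) :
    ¬ A.Before B := by
  rintro ⟨ht, hb⟩
  obtain ⟨h0, h1, -, h2⟩ := hA
  obtain ⟨-, -, h3, -⟩ := hB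
  have e1 : 0 ≤ (1 - p.2) * (B.lb - A.rb) := mul_nonneg (by linarith) (by linarith)
  have e2 : 0 ≤ p.2 * (B.lt - A.rt) := mul_nonneg h0 (by linarith)
  rcases h0.eq_or_lt with h | h
  · rw [← h] at h2 h3
    linarith
  · have e3 : 0 < p.2 * (B.lt - A.rt) := mul_pos h (by linarith)
    linarith

theorem nonempty_of_height {A B : Trap} {t : ℝ} (h0 : 0 ≤ t) (h1 : t ≤ 1)
    (hAB : (1 - t) * A.lb + t * A.lt ≤ (1 - t) * B.rb + t * B.rt)
    (hBA : (1 - t) * B.lb + t * B.lt ≤ (1 - t) * A.rb + t * A.rt) :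
    (A.points ∩ B.points).Nonempty := by
  have hA : (1 - t) * A.lb + t * A.lt ≤ (1 - t) * A.rb + t * A.rt := by
    have := A.top_le
    have := A.bot_le
    have : 0 ≤ 1 - t := by linarith
    gcongr
  have hB : (1 - t) * B.lb + t * B.lt ≤ (1 - t) * B.rb + t * B.rt := by
    have := B.top_le
    have := B.bot_le
    have : 0 ≤ 1 - t := by linarith
    gcongr
  exact ⟨(max ((1 - t) * A.lb + t * A.lt) ((1 - t) * B.lb + t * B.lt), t),
    ⟨h0, h1, le_max_left _ _, max_le hA hBA⟩, ⟨h0, h1, le_max_right _ _, max_le hAB hB⟩⟩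

/-- If the bottom side of `B` is to the left of that of `A`, but the top side is not, then the right
side of `B` crosses the left side of `A`. -/
theorem nonempty_of_bot_lt {A B : Trap} (hb : B.rb < A.lb) (ht : A.lt ≤ B.rt) :
    (A.points ∩ B.points).Nonempty := by
  have hd : 0 < (A.lb - B.rb) + (B.rt - A.lt) := by linarith
  -- The height at which the right side of `B` meets the left side of `A`: their signed distance is
  -- linear in the height, equal to `A.lb - B.rb` at 0 and to `A.lt - B.rt` at 1.
  obtain ⟨t, ht'⟩ : ∃ t, t = (A.lb - B.rb) / ((A.lb - B.rb) + (B.rt - A.lt)) := ⟨_, rfl⟩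
  have h0 : 0 ≤ t := by rw [ht']; exact div_nonneg (by linarith) hd.le
  have h1 : t ≤ 1 := by rw [ht', div_le_one hd]; linarith
  have he : (1 - t) * A.lb + t * A.lt = (1 - t) * B.rb + t * B.rt := by
    have : t * ((A.lb - B.rb) + (B.rt - A.lt)) = A.lb - B.rb := by
      rw [ht', div_mul_cancel₀ _ hd.ne']
    linear_combination -this
  have h1' : 0 ≤ 1 - t := by linarith
  refine nonempty_of_height h0 h1 he.le ?_
  have e1 := mul_le_mul_of_nonneg_left A.top_le h0
  have e2 := mul_le_mul_of_nonneg_left A.bot_le h1'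
  have e3 := mul_le_mul_of_nonneg_left B.top_le h0
  have e4 := mul_le_mul_of_nonneg_left B.bot_le h1'
  linarith

theorem points_inter_nonempty_iff {A B : Trap} : (A.points ∩ B.points).Nonempty ↔ A.Meets B := by
  constructor
  · rintro ⟨p, hA, hB⟩
    exact ⟨not_before_of_mem hA hB, not_before_of_mem hB hA⟩
  · rintro ⟨hAB, hBA⟩
    by_cases h1 : B.rb < A.lb
    · refine nonempty_of_bot_lt h1 (not_lt.1 fun h => hBA ⟨h, h1⟩)
    by_cases h2 : A.rb < B.lb
    · rw [Set.inter_comm]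
      refine nonempty_of_bot_lt h2 (not_lt.1 fun h => hAB ⟨h, h2⟩)
    refine nonempty_of_height (t := 0) le_rfl zero_le_one ?_ ?_ <;> linarith

end Trap

/-- The trapezoid of `v` in a trapezoid representation. -/
def TrapezoidRep.trap {V : Type u} (R : TrapezoidRep V) (v : V) : Trap :=
  ⟨R.lines.top (v, false), R.lines.top (v, true), R.lines.bot (v, false), R.lines.bot (v, true),
    (R.top_lt v).le, (R.bot_lt v).le⟩

/-! ### Adjacency and orientation in terms of the order of endpoints -/

theorem TrapezoidRep.graph_adj {V : Type u} (R : TrapezoidRep V) {v w : V} :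
    R.graph.Adj v w ↔ v ≠ w ∧ (R.trap v).Meets (R.trap w) := by
  rw [← Trap.points_inter_nonempty_iff]
  rfl

theorem PermRep.line_eq {W : Type u} (R : PermRep W) (w : W) :
    R.line w = (Trap.ofLine (R.top w) (R.bot w)).points := by
  ext p
  constructor
  · rintro ⟨h0, h1, h⟩
    exact ⟨h0, h1, h.ge, h.le⟩
  · rintro ⟨h0, h1, h, h'⟩
    exact ⟨h0, h1, le_antisymm h' h⟩

theorem PermRep.graph_adj {W : Type u} (R : PermRep W) {x y : W} :
    R.graph.Adj x y ↔ x ≠ y ∧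
      (Trap.ofLine (R.top x) (R.bot x)).Meets (Trap.ofLine (R.top y) (R.bot y)) := by
  rw [← Trap.points_inter_nonempty_iff, ← R.line_eq, ← R.line_eq]
  rfl

/-- With `a = top - bot`, the argument of `a + i` is the arccosine of `a / √(1 + a ^ 2)`, and this
quotient is the sine of `arctan a`. -/
theorem PermRep.angle_eq {W : Type u} (R : PermRep W) (w : W) :
    R.angle w = Real.pi / 2 - Real.arctan (R.top w - R.bot w) := by
  set a := R.top w - R.bot w with ha
  have hz : Complex.mk a 1 ≠ 0 := fun h => by simpa using congrArg Complex.im h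
  have hn : ‖Complex.mk a 1‖ = √(1 + a ^ 2) := by
    rw [Complex.norm_def, Complex.normSq_apply]
    congr 1
    ring
  rw [PermRep.angle, ← ha, Complex.arg_of_im_nonneg_of_ne_zero (by simp) hz, hn, Real.arccos]
  congr 1
  rw [show (Complex.mk a 1).re = a from rfl, ← Real.sin_arctan,
    Real.arcsin_sin (Real.neg_pi_div_two_lt_arctan a).le (Real.arctan_lt_pi_div_two a).le]

/-- The angle decreases as `top - bot` grows, while crossing segments have opposite orders on the
two lines; comparing angles decides which of the two orders occurs. -/
theorem PermRep.orient_iff {W : Type u} (R : PermRep W) {x y : W} :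
    R.orient x y ↔ R.top y < R.top x ∧ R.bot x < R.bot y := by
  rw [PermRep.orient, R.graph_adj, R.angle_eq, R.angle_eq]
  have : Real.pi / 2 - Real.arctan (R.top x - R.bot x) <
      Real.pi / 2 - Real.arctan (R.top y - R.bot y) ↔
      R.top y - R.bot y < R.top x - R.bot x := by
    rw [sub_lt_sub_iff_left, Real.arctan_strictMono.lt_iff_lt]
  rw [this]
  simp only [Trap.Meets, Trap.Before, Trap.ofLine, not_and, not_lt]
  constructor
  · rintro ⟨⟨hne, h1, h2⟩, h⟩
    rcases lt_or_gt_of_ne (R.top_injective.ne hne) with ht | ht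
    · have := h1 ht
      linarith
    · exact ⟨ht, lt_of_le_of_ne (h2 ht) (R.bot_injective.ne hne)⟩
  · rintro ⟨ht, hb⟩
    refine ⟨⟨?_, fun h => ?_, fun _ => hb.le⟩, by linarith⟩
    · rintro rfl
      exact lt_irrefl _ ht
    · linarith

/-! ### Connected components of `G \ N[u]` -/

namespace SplitU

variable {W : Type u} {H : SimpleGraph W} {u : W}

theorem not_mem_closedNbhd_of_mem {D : Set W} (hD : D ∈ components H u) {z : W} (hz : z ∈ D) :
    z ≠ u ∧ ¬ H.Adj u z := by
  obtain ⟨c, rfl⟩ := hD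
  obtain ⟨⟨z, hz'⟩, -, rfl⟩ := hz
  simpa [not_or] using hz'

theorem exists_mem_components {z : W} (hz : z ≠ u) (hz' : ¬ H.Adj u z) :
    ∃ D ∈ components H u, z ∈ D :=
  let z' : ((insert u (H.neighborSet u))ᶜ : Set W) := ⟨z, by simpa [not_or] using ⟨hz, hz'⟩⟩
  ⟨_, ⟨(H.induce (insert u (H.neighborSet u))ᶜ).connectedComponentMk z', rfl⟩, z', rfl, rfl⟩

theorem components_nonempty_of_mem {D : Set W} (hD : D ∈ components H u) : D.Nonempty := by
  obtain ⟨c, rfl⟩ := hD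
  exact c.nonempty_supp.image _

theorem mem_of_adj {D : Set W} (hD : D ∈ components H u) {z z' : W} (hz : z ∈ D)
    (hne : z' ≠ u) (hnadj : ¬ H.Adj u z') (h : H.Adj z z') : z' ∈ D := by
  obtain ⟨c, rfl⟩ := hD
  obtain ⟨z, hzc, rfl⟩ := hz
  refine ⟨⟨z', by simpa [not_or] using ⟨hne, hnadj⟩⟩, ?_, rfl⟩
  exact SimpleGraph.ConnectedComponent.mem_supp_of_adj_mem_supp c hzc h

theorem components_induction {D : Set W} (hD : D ∈ components H u) {P : W → Prop}
    (hP : ∀ a b, a ≠ u → ¬ H.Adj u a → b ≠ u → ¬ H.Adj u b → H.Adj a b → P a → P b)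
    {z z' : W} (hz : z ∈ D) (hz' : z' ∈ D) (h : P z) : P z' := by
  obtain ⟨c, rfl⟩ := hD
  obtain ⟨z, hzc, rfl⟩ := hz
  obtain ⟨z', hzc', rfl⟩ := hz'
  have hr := c.reachable_of_mem_supp hzc hzc'
  rw [SimpleGraph.reachable_iff_reflTransGen] at hr
  clear hzc hzc'
  induction hr with
  | refl => exact h
  | @tail a b _ hab ih =>
    have ha : a.1 ≠ u ∧ ¬ H.Adj u a.1 := not_or.1 a.2
    have hb : b.1 ≠ u ∧ ¬ H.Adj u b.1 := not_or.1 b.2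
    exact hP a b ha.1 ha.2 hb.1 hb.2 hab ih

/-- A neighbor of a component lying outside $N[u]$ would belong to the component, so only neighbors
of $u$ remain. -/
theorem mem_nbhd_iff {D : Set W} (hD : D ∈ components H u) {x : W} :
    x ∈ nbhd H D ↔ H.Adj u x ∧ AdjTo H x D := by
  simp only [nbhd, AdjTo, Set.mem_sdiff, Set.mem_iUnion, SimpleGraph.mem_neighborSet, exists_prop]
  constructor
  · rintro ⟨⟨z, hz, hzx⟩, hx⟩
    refine ⟨?_, z, hz, hzx.symm⟩
    by_contra h
    have hxu : x ≠ u := by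
      rintro rfl
      exact (not_mem_closedNbhd_of_mem hD hz).2 hzx.symm
    exact hx (mem_of_adj hD hz hxu h hzx)
  · rintro ⟨hux, z, hz, hxz⟩
    exact ⟨⟨z, hz, hxz.symm⟩, fun hx => (not_mem_closedNbhd_of_mem hD hx).2 hux⟩

theorem mem_derivNbrs_false {δ δs : Set W} (hδ : δ ∈ components H u) {x : W} :
    x ∈ derivNbrs H u δ δs false ↔ x ∈ nbhd H δ := by
  rw [mem_nbhd_iff hδ]
  simp only [derivNbrs, N₁, N₁₂, Set.mem_union, Set.mem_ofPred_eq]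
  tauto

/-- Phrased with `AdjTo` to cover `δs = ∅`, which is not a component. -/
theorem mem_derivNbrs_true {δ δs : Set W} {x : W} :
    x ∈ derivNbrs H u δ δs true ↔ H.Adj u x ∧ AdjTo H x δs := by
  simp only [derivNbrs, N₂, N₁₂, Set.mem_union, Set.mem_ofPred_eq]
  tauto

/-- Since `A` is attained by some `L`, the closure of `δ` is contained in that of `L`; maximum
cardinality makes them equal, so `L` is dominated by `δ`. Components outside this closure are then
bounded by `B`, and a component attaining `B` is itself outside, so a maximal one has neighborhood
`B`. -/
theorem nbhd_eq_of_isDelta_of_subset [Finite W] {δ δs A B : Set W} (hδ : IsDelta H u δ δs)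
    (hA : nbhd H δ ⊆ A) (hA' : ∃ L ∈ components H u, nbhd H L = A)
    (h : ∀ D ∈ components H u, nbhd H D ⊆ A ∨
      (nbhd H D ⊆ B ∧ ∃ L ∈ components H u, nbhd H L = B)) :
    nbhd H δ = A ∧ (δs = ∅ ∨ (δs ∈ components H u ∧ nbhd H δs = B)) := by
  obtain ⟨⟨hδc, hmax⟩, hemp, hne⟩ := hδ
  obtain ⟨L, hLc, rfl⟩ := hA'
  have hsub : domClosure H u δ ⊆ domClosure H u L := fun D hD => ⟨hD.1, hD.2.trans hA⟩
  have heq := Set.eq_of_subset_of_ncard_le hsub (hmax L hLc) (Set.toFinite _)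
  have hL : L ∈ domClosure H u δ := by rw [heq]; exact ⟨hLc, subset_rfl⟩
  have hδL : nbhd H δ = nbhd H L := hA.antisymm hL.2
  refine ⟨hδL, ?_⟩
  by_cases hc : closureCompl H u δ = ∅
  · exact Or.inl (hemp hc)
  obtain ⟨hs, hsmax⟩ := hne hc
  refine Or.inr ⟨hs.1, ?_⟩
  have hsn : ¬ nbhd H δs ⊆ nbhd H L := fun h' => hs.2 ⟨hs.1, by rwa [hδL]⟩
  obtain ⟨hsB, M, hM, rfl⟩ := (h δs hs.1).resolve_left hsn
  by_contra hcon
  refine hsmax M ⟨hM, fun hM' => hsn (hsB.trans (hM'.2.trans hδL.le))⟩ ?_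
  exact hsB.ssubset_of_ne hcon

theorem exists_isDelta [Finite W] {z : W} (hz : z ≠ u) (hz' : ¬ H.Adj u z) :
    ∃ δ δs : Set W, IsDelta H u δ δs := by
  obtain ⟨D, hD, -⟩ := exists_mem_components hz hz'
  obtain ⟨δ, hδ, hmax⟩ := Set.exists_max_image (components H u)
    (fun C => (domClosure H u C).ncard) (Set.toFinite _) ⟨D, hD⟩
  by_cases hc : closureCompl H u δ = ∅
  · exact ⟨δ, ∅, ⟨hδ, hmax⟩, fun _ => rfl, fun h => absurd hc h⟩
  · obtain ⟨δs, hs, hsmax⟩ := Set.exists_max_image (closureCompl H u δ)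
      (fun C => (nbhd H C).ncard) (Set.toFinite _) (Set.nonempty_iff_ne_empty.2 hc)
    refine ⟨δ, δs, ⟨hδ, hmax⟩, fun h => absurd h hc, fun _ => ⟨hs, fun D hD hlt => ?_⟩⟩
    exact absurd (hsmax D hD) (not_le.2 (Set.ncard_lt_ncard hlt (Set.toFinite _)))

/-! ### The two sides of a vertex in a representation -/

/-- `S` represents `H` by possibly degenerate trapezoids. -/
def Represents (S : W → Trap) (H : SimpleGraph W) : Prop :=
  ∀ w w', H.Adj w w' ↔ w ≠ w' ∧ (S w).Meets (S w')

/-- The neighbors of `u` with a neighbor to the left of `u`. -/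
def leftNbrs (S : W → Trap) (H : SimpleGraph W) (u : W) : Set W :=
  {x | H.Adj u x ∧ ∃ z, (S z).Before (S u) ∧ H.Adj x z}

/-- The neighbors of `u` with a neighbor to the right of `u`. -/
def rightNbrs (S : W → Trap) (H : SimpleGraph W) (u : W) : Set W :=
  {x | H.Adj u x ∧ ∃ z, (S u).Before (S z) ∧ H.Adj x z}

variable {S : W → Trap}

theorem Represents.reflect (hS : Represents S H) : Represents (fun w => (S w).reflect) H :=
  fun w w' => by simp [hS w w']

theorem leftNbrs_reflect : leftNbrs (fun w => (S w).reflect) H u = rightNbrs S H u := by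
  simp [leftNbrs, rightNbrs]

theorem Represents.not_adj (hS : Represents S H) {w w' : W} (h : (S w).Before (S w')) :
    ¬ H.Adj w w' := fun h' => ((hS _ _).1 h').2.1 h

theorem Represents.before_or_before (hS : Represents S H) {w w' : W} (hne : w ≠ w')
    (h : ¬ H.Adj w w') : (S w).Before (S w') ∨ (S w').Before (S w) := by
  by_contra hcon
  rw [not_or] at hcon
  exact h ((hS _ _).2 ⟨hne, hcon.1, hcon.2⟩)

/-- A walk avoiding $N[u]$ cannot jump over `u`: vertices strictly on opposite sides of `u` are not
adjacent. -/
theorem Represents.left_of_mem (hS : Represents S H) {D : Set W} (hD : D ∈ components H u)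
    {z z' : W} (hz : z ∈ D) (hz' : z' ∈ D) (h : (S z).Before (S u)) : (S z').Before (S u) := by
  refine components_induction hD (P := fun z => (S z).Before (S u)) ?_ hz hz' h
  intro a b _ _ hb hb' hab ha
  rcases hS.before_or_before hb (fun h => hb' h.symm) with h | h
  · exact h
  · exact absurd hab (hS.not_adj (ha.trans h))

theorem Represents.nbhd_subset_leftNbrs (hS : Represents S H) {D : Set W}
    (hD : D ∈ components H u) {z : W} (hz : z ∈ D) (h : (S z).Before (S u)) :
    nbhd H D ⊆ leftNbrs S H u := by
  intro x hx
  obtain ⟨hux, z', hz', hxz'⟩ := (mem_nbhd_iff hD).1 hx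
  exact ⟨hux, z', hS.left_of_mem hD hz hz' h, hxz'⟩

theorem Represents.exists_nbhd_eq_leftNbrs [Finite W] (hS : Represents S H) {z : W}
    (h : (S z).Before (S u)) : ∃ L ∈ components H u, nbhd H L = leftNbrs S H u := by
  -- The left vertex reaching furthest right on the upper line. Any left vertex `y` of another
  -- component lies before `m`, so a common neighbor `x` of `y` and `u` has to cross `m`.
  obtain ⟨m, hm, hmax⟩ := Set.exists_max_image {z | (S z).Before (S u)}
    (fun z => (S z).rt) (Set.toFinite _) ⟨z, h⟩
  have hmu : ∀ {z}, (S z).Before (S u) → z ≠ u ∧ ¬ H.Adj u z := fun {z} hz =>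
    ⟨by rintro rfl; exact hz.irrefl, fun h' => hS.not_adj hz h'.symm⟩
  obtain ⟨L, hL, hmL⟩ := exists_mem_components (hmu hm).1 (hmu hm).2
  refine ⟨L, hL, (hS.nbhd_subset_leftNbrs hL hmL hm).antisymm ?_⟩
  rintro x ⟨hux, y, hy, hxy⟩
  rw [mem_nbhd_iff hL]
  refine ⟨hux, ?_⟩
  by_cases hyL : y ∈ L
  · exact ⟨y, hyL, hxy⟩
  refine ⟨m, hmL, ?_⟩
  have hmy : ¬ H.Adj m y := fun h' => hyL (mem_of_adj hL hmL (hmu hy).1 (hmu hy).2 h')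
  have hne : m ≠ y := by rintro rfl; exact hyL hmL
  have hym : (S y).Before (S m) := by
    rcases hS.before_or_before hne hmy with h' | h'
    · have := hmax y hy
      have := h'.1
      have := (S y).top_le
      linarith
    · exact h'
  have hxm : x ≠ m := by
    rintro rfl
    exact (hmu hm).2 hux
  by_contra hcon
  rcases hS.before_or_before hxm hcon with h' | h'
  · exact hS.not_adj (h'.trans hm) hux.symm
  · exact hS.not_adj (hym.trans h') hxy.symm

/-- The side containing `δ` plays the role of `A` in `nbhd_eq_of_isDelta_of_subset`, the opposite
side that of `B`. -/
theorem Represents.nbhd_eq_of_isDelta [Finite W] (hS : Represents S H) {δ δs : Set W}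
    (hδ : IsDelta H u δ δs) :
    (nbhd H δ = leftNbrs S H u ∧
      (δs = ∅ ∨ (δs ∈ components H u ∧ nbhd H δs = rightNbrs S H u))) ∨
    (nbhd H δ = rightNbrs S H u ∧
      (δs = ∅ ∨ (δs ∈ components H u ∧ nbhd H δs = leftNbrs S H u))) := by
  have key : ∀ D ∈ components H u,
      (nbhd H D ⊆ leftNbrs S H u ∧ ∃ L ∈ components H u, nbhd H L = leftNbrs S H u) ∨
      (nbhd H D ⊆ rightNbrs S H u ∧ ∃ L ∈ components H u, nbhd H L = rightNbrs S H u) := by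
    intro D hD
    obtain ⟨z, hz⟩ := components_nonempty_of_mem hD
    obtain ⟨hzu, hzu'⟩ := not_mem_closedNbhd_of_mem hD hz
    rcases hS.before_or_before hzu (fun h => hzu' h.symm) with h | h
    · exact Or.inl ⟨hS.nbhd_subset_leftNbrs hD hz h, hS.exists_nbhd_eq_leftNbrs h⟩
    · right
      rw [← leftNbrs_reflect]
      have h' : (S z).reflect.Before (S u).reflect := by simpa using h
      exact ⟨hS.reflect.nbhd_subset_leftNbrs hD hz h', hS.reflect.exists_nbhd_eq_leftNbrs h'⟩
  rcases key δ hδ.1.1 with h | h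
  · exact Or.inl (nbhd_eq_of_isDelta_of_subset hδ h.1 h.2 fun D hD => (key D hD).imp_left And.left)
  · exact Or.inr (nbhd_eq_of_isDelta_of_subset hδ h.1 h.2
      fun D hD => (key D hD).symm.imp_left And.left)

/-! ### New lines next to a vertex -/

theorem exists_lt_gap {s : Set ℝ} (hs : s.Finite) (m : ℝ) :
    ∃ a < m, ∀ x ∈ s, x < m → x < a := by
  rcases (s ∩ Set.Iio m).eq_empty_or_nonempty with h | h
  · exact ⟨m - 1, by linarith, fun x hx hxm => absurd (h.le ⟨hx, hxm⟩) (Set.notMem_empty x)⟩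
  · obtain ⟨c, hc, hmax⟩ := Set.exists_max_image _ id (hs.inter_of_left (Set.Iio m)) h
    obtain ⟨a, hca, ham⟩ := exists_between (Set.mem_Iio.1 hc.2)
    exact ⟨a, ham, fun x hx hxm => (hmax x ⟨hx, hxm⟩).trans_lt hca⟩

/-- The segment from `a` on the upper line to `b` on the lower line shares no endpoint with the
trapezoids of `S`. -/
def Fresh (S : W → Trap) (a b : ℝ) : Prop :=
  ∀ w, (S w).lt ≠ a ∧ (S w).rt ≠ a ∧ (S w).lb ≠ b ∧ (S w).rb ≠ b

theorem Represents.exists_left_line [Finite W] (hS : Represents S H) (u : W) :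
    ∃ a b, Fresh S a b ∧ (Trap.ofLine a b).Before (S u) ∧
      (∀ z, (S z).Before (S u) → (S z).Before (Trap.ofLine a b)) ∧
      ∀ x ≠ u, x ∈ leftNbrs S H u ↔ (Trap.ofLine a b).Meets (S x) := by
  -- The vertices that must lie to the right of the new line. Every vertex left of `u` precedes all
  -- of them, so the line fits between; its upper and lower endpoints are placed just before the
  -- minima over `X`, which may be attained at different vertices `p` and `q`.
  let X : Set W := {x | ¬ (S x).Before (S u) ∧ ∀ z, (S z).Before (S u) → ¬ H.Adj x z}
  have huX : u ∈ X := ⟨Trap.Before.irrefl, fun z hz h => hS.not_adj hz h.symm⟩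
  have hzX : ∀ z, (S z).Before (S u) → ∀ x ∈ X, (S z).Before (S x) := by
    intro z hz x hx
    have hne : z ≠ x := by rintro rfl; exact hx.1 hz
    exact (hS.before_or_before hne fun h => hx.2 z hz h.symm).resolve_right
      fun h => hx.1 (h.trans hz)
  obtain ⟨p, hp, hpmin⟩ := Set.exists_min_image X (fun x => (S x).lt) (Set.toFinite _) ⟨u, huX⟩
  obtain ⟨q, hq, hqmin⟩ := Set.exists_min_image X (fun x => (S x).lb) (Set.toFinite _) ⟨u, huX⟩
  obtain ⟨a, hap, ha⟩ := exists_lt_gap ((Set.finite_range fun w => (S w).lt).union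
    (Set.finite_range fun w => (S w).rt)) (S p).lt
  obtain ⟨b, hbq, hb⟩ := exists_lt_gap ((Set.finite_range fun w => (S w).lb).union
    (Set.finite_range fun w => (S w).rb)) (S q).lb
  have hX : ∀ x ∈ X, (Trap.ofLine a b).Before (S x) := fun x hx =>
    ⟨hap.trans_le (hpmin x hx), hbq.trans_le (hqmin x hx)⟩
  have hz : ∀ z, (S z).Before (S u) → (S z).Before (Trap.ofLine a b) := fun z hz =>
    ⟨ha _ (Or.inr ⟨z, rfl⟩) (hzX z hz p hp).1, hb _ (Or.inr ⟨z, rfl⟩) (hzX z hz q hq).2⟩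
  have fresh : ∀ {s : Set ℝ} {m c : ℝ}, c < m → (∀ x ∈ s, x < m → x < c) → ∀ x ∈ s, x ≠ c := by
    rintro s m c hcm hc x hx rfl
    exact lt_irrefl _ (hc x hx hcm)
  refine ⟨a, b, fun w => ⟨fresh hap ha _ (Or.inl ⟨w, rfl⟩), fresh hap ha _ (Or.inr ⟨w, rfl⟩),
    fresh hbq hb _ (Or.inl ⟨w, rfl⟩), fresh hbq hb _ (Or.inr ⟨w, rfl⟩)⟩, hX u huX, hz,
    fun x hxu => ⟨?_, ?_⟩⟩
  · rintro ⟨hux, z, hzu, hxz⟩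
    exact ⟨fun h => hS.not_adj ((hz z hzu).trans h) hxz.symm,
      fun h => hS.not_adj (h.trans (hX u huX)) hux.symm⟩
  · rintro ⟨h1, h2⟩
    have hxu' : ¬ (S x).Before (S u) := fun h => h2 (hz x h)
    have hxX : ¬ x ∈ X := fun h => h1 (hX x h)
    obtain ⟨z, hzu, hxz⟩ : ∃ z, (S z).Before (S u) ∧ H.Adj x z := by
      by_contra hcon
      push Not at hcon
      exact hxX ⟨hxu', hcon⟩
    refine ⟨?_, z, hzu, hxz⟩
    by_contra hcon
    rcases hS.before_or_before hxu.symm hcon with h | h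
    · exact hS.not_adj (hzu.trans h) hxz.symm
    · exact hxu' h

theorem Represents.exists_right_line [Finite W] (hS : Represents S H) (u : W) :
    ∃ a b, Fresh S a b ∧ (S u).Before (Trap.ofLine a b) ∧
      (∀ z, (S u).Before (S z) → (Trap.ofLine a b).Before (S z)) ∧
      ∀ x ≠ u, x ∈ rightNbrs S H u ↔ (Trap.ofLine a b).Meets (S x) := by
  obtain ⟨a, b, hf, h1, h2, h3⟩ := hS.reflect.exists_left_line u
  have e : Trap.ofLine a b = (Trap.ofLine (-a) (-b)).reflect := by
    simp [Trap.ofLine_reflect]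
  rw [e] at h1 h2 h3
  simp only [leftNbrs_reflect, Trap.reflect_before, Trap.reflect_meets] at h1 h2 h3
  refine ⟨-a, -b, fun w => ?_, h1, h2, h3⟩
  obtain ⟨f1, f2, f3, f4⟩ := hf w
  refine ⟨fun h => f2 ?_, fun h => f1 ?_, fun h => f4 ?_, fun h => f3 ?_⟩ <;>
    simp [Trap.reflect, h]

/-- Serves a derivative without neighbors. The bounds `a'`, `b'` keep it from crossing the line of
the other derivative. -/
theorem exists_far_line [Finite W] (S : W → Trap) (a' b' : ℝ) :
    ∃ a b, Fresh S a b ∧ a < a' ∧ b < b' ∧ ∀ x, (Trap.ofLine a b).Before (S x) := by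
  obtain ⟨a, ha⟩ := ((Set.finite_range fun w => (S w).lt).insert a').bddBelow
  obtain ⟨b, hb⟩ := ((Set.finite_range fun w => (S w).lb).insert b').bddBelow
  have h1 : ∀ w, a ≤ (S w).lt := fun w => ha (Or.inr ⟨w, rfl⟩)
  have h2 : ∀ w, b ≤ (S w).lb := fun w => hb (Or.inr ⟨w, rfl⟩)
  have h3 : a ≤ a' := ha (Or.inl rfl)
  have h4 : b ≤ b' := hb (Or.inl rfl)
  refine ⟨a - 1, b - 1, fun w => ?_, by linarith, by linarith, fun w => ?_⟩
  · have := h1 w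
    have := h2 w
    have := (S w).top_le
    have := (S w).bot_le
    refine ⟨?_, ?_, ?_, ?_⟩ <;> apply ne_of_gt <;> linarith
  · have := h1 w
    have := h2 w
    exact ⟨by simp only [Trap.ofLine]; linarith, by simp only [Trap.ofLine]; linarith⟩

end SplitU

namespace SplitU

/-! ### The representations maintained by the algorithm -/

variable {V W : Type u}

/-- `N` is the set of neighbors of the derivative of `u` represented by the segment from `a` to `b`;
this segment lies on one side of `u`, with each member of `N` having a neighbor on the far side of
the segment, or `N` is empty. -/
structure DerivLine (S : W → Trap) (H : SimpleGraph W) (u : W) (N : Set W) (a b : ℝ) : Prop where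
  fresh : Fresh S a b
  mem_iff : ∀ x ≠ u, x ∈ N ↔ (Trap.ofLine a b).Meets (S x)
  side : ((Trap.ofLine a b).Before (S u) ∧
      ∀ x ∈ N, ∃ z, (S z).Before (Trap.ofLine a b) ∧ H.Adj x z) ∨
    ((S u).Before (Trap.ofLine a b) ∧
      ∀ x ∈ N, ∃ z, (Trap.ofLine a b).Before (S z) ∧ H.Adj x z) ∨ N = ∅

theorem Represents.exists_derivLine [Finite W] {S : W → Trap} {H : SimpleGraph W} {u : W}
    (hS : Represents S H) {δ δs : Set W} (hδ : IsDelta H u δ δs) :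
    ∃ a b : Bool → ℝ, (∀ i, DerivLine S H u (derivNbrs H u δ δs i) (a i) (b i)) ∧
      ((Trap.ofLine (a false) (b false)).Before (Trap.ofLine (a true) (b true)) ∨
        (Trap.ofLine (a true) (b true)).Before (Trap.ofLine (a false) (b false))) := by
  obtain ⟨aL, bL, hLf, hLu, hLz, hLx⟩ := hS.exists_left_line u
  obtain ⟨aR, bR, hRf, hRu, hRz, hRx⟩ := hS.exists_right_line u
  obtain ⟨aI, bI, hIf, hIa, hIb, hIx⟩ := exists_far_line S (min aL aR) (min bL bR)
  rw [lt_min_iff] at hIa hIb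
  have hL : DerivLine S H u (leftNbrs S H u) aL bL :=
    ⟨hLf, hLx, Or.inl ⟨hLu, fun x ⟨_, z, hz, hxz⟩ => ⟨z, hLz z hz, hxz⟩⟩⟩
  have hR : DerivLine S H u (rightNbrs S H u) aR bR :=
    ⟨hRf, hRx, Or.inr (Or.inl ⟨hRu, fun x ⟨_, z, hz, hxz⟩ => ⟨z, hRz z hz, hxz⟩⟩)⟩
  have hI : DerivLine S H u ∅ aI bI :=
    ⟨hIf, fun x _ => ⟨fun h => h.elim, fun h => h.1 (hIx x)⟩, Or.inr (Or.inr rfl)⟩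
  have hLR : (Trap.ofLine aL bL).Before (Trap.ofLine aR bR) := hLu.trans hRu
  have hIL : (Trap.ofLine aI bI).Before (Trap.ofLine aL bL) := ⟨hIa.1, hIb.1⟩
  have hIR : (Trap.ofLine aI bI).Before (Trap.ofLine aR bR) := ⟨hIa.2, hIb.2⟩
  have h0 : derivNbrs H u δ δs false = nbhd H δ := Set.ext fun x => mem_derivNbrs_false hδ.1.1
  have h1 : δs = ∅ → derivNbrs H u δ δs true = ∅ := by
    rintro rfl
    ext x
    simp [mem_derivNbrs_true, AdjTo]
  have h1' : δs ∈ components H u → derivNbrs H u δ δs true = nbhd H δs := fun h =>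
    Set.ext fun x => by rw [mem_derivNbrs_true, mem_nbhd_iff h]
  have build : ∀ {a₀ b₀ a₁ b₁ : ℝ}, DerivLine S H u (derivNbrs H u δ δs false) a₀ b₀ →
      DerivLine S H u (derivNbrs H u δ δs true) a₁ b₁ →
      ((Trap.ofLine a₀ b₀).Before (Trap.ofLine a₁ b₁) ∨
        (Trap.ofLine a₁ b₁).Before (Trap.ofLine a₀ b₀)) →
      ∃ a b : Bool → ℝ, (∀ i, DerivLine S H u (derivNbrs H u δ δs i) (a i) (b i)) ∧
        ((Trap.ofLine (a false) (b false)).Before (Trap.ofLine (a true) (b true)) ∨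
          (Trap.ofLine (a true) (b true)).Before (Trap.ofLine (a false) (b false))) := by
    intro a₀ b₀ a₁ b₁ d₀ d₁ h
    refine ⟨fun i => cond i a₁ a₀, fun i => cond i b₁ b₀, fun i => ?_, h⟩
    cases i
    · exact d₀
    · exact d₁
  rcases hS.nbhd_eq_of_isDelta hδ with ⟨e, he | ⟨hc, he⟩⟩ | ⟨e, he | ⟨hc, he⟩⟩
  · exact build (by rwa [h0, e]) (by rwa [h1 he]) (Or.inr hIL)
  · exact build (by rwa [h0, e]) (by rwa [h1' hc, he]) (Or.inl hLR)
  · exact build (by rwa [h0, e]) (by rwa [h1 he]) (Or.inr hIR)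
  · exact build (by rwa [h0, e]) (by rwa [h1' hc, he]) (Or.inr hLR)

/-- The line of `w` is to the left of the original trapezoid, and every neighbor of `w` stems from a
vertex with a neighbor to the left of this line. -/
def IsLeftDeriv (R : TrapezoidRep V) (H : SimpleGraph W) (π : W → V) (S : W → Trap) (w : W) :
    Prop :=
  (S w).Before (R.trap (π w)) ∧
    ∀ x, H.Adj x w → ∃ z, (R.trap z).Before (S w) ∧ R.graph.Adj (π x) z

/-- The line of `w` is to the right of the original trapezoid, and every neighbor of `w` stems from a
vertex with a neighbor to the right of this line. -/
def IsRightDeriv (R : TrapezoidRep V) (H : SimpleGraph W) (π : W → V) (S : W → Trap) (w : W) :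
    Prop :=
  (R.trap (π w)).Before (S w) ∧
    ∀ x, H.Adj x w → ∃ z, (S w).Before (R.trap z) ∧ R.graph.Adj (π x) z

/-- `S` represents the graph `H` that stems from the graph of `R` by splitting the vertices in
`done`: unsplit vertices keep their trapezoids and derivatives are represented by lines. -/
structure IsSplitRep (R : TrapezoidRep V) (H : SimpleGraph W) (π : W → V) (S : W → Trap)
    (done : Set V) : Prop where
  represents : Represents S H
  adj : ∀ w w', H.Adj w w' → R.graph.Adj (π w) (π w')
  unsplit : ∀ w, π w ∉ done → S w = R.trap (π w)
  line : ∀ w, π w ∈ done → ∃ a b, S w = Trap.ofLine a b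
  side : ∀ w, π w ∈ done →
    IsLeftDeriv R H π S w ∨ IsRightDeriv R H π S w ∨ ∀ x, ¬ H.Adj x w
  lt_injective : Function.Injective fun w => (S w).lt
  lb_injective : Function.Injective fun w => (S w).lb

theorem isSplitRep_init (R : TrapezoidRep V) : IsSplitRep R R.graph id R.trap ∅ where
  represents _ _ := R.graph_adj
  adj _ _ h := h
  unsplit _ _ := rfl
  line _ h := h.elim
  side _ h := h.elim
  lt_injective _ _ h := congrArg Prod.fst (R.lines.top_injective h)
  lb_injective _ _ h := congrArg Prod.fst (R.lines.bot_injective h)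

namespace IsSplitRep

variable {R : TrapezoidRep V} {H : SimpleGraph W} {π : W → V} {S : W → Trap} {done : Set V}

/-- Turns a witness `z` in the current graph into one in the original graph. If `z` is a right
derivative, its original trapezoid lies even further left; if it is a left derivative, its own
invariant supplies a trapezoid beyond it. -/
theorem exists_trap_before (h : IsSplitRep R H π S done) {A : Trap} {x z : W}
    (hz : (S z).Before A) (hxz : H.Adj x z) :
    ∃ v, (R.trap v).Before A ∧ R.graph.Adj (π x) v := by
  by_cases hd : π z ∈ done
  · rcases h.side z hd with hl | hr | hn
    · obtain ⟨v, hv, hxv⟩ := hl.2 x hxz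
      exact ⟨v, hv.trans hz, hxv⟩
    · exact ⟨π z, hr.1.trans hz, h.adj _ _ hxz⟩
    · exact absurd hxz (hn x)
  · exact ⟨π z, by rwa [← h.unsplit z hd], h.adj _ _ hxz⟩

theorem exists_before_trap (h : IsSplitRep R H π S done) {A : Trap} {x z : W}
    (hz : A.Before (S z)) (hxz : H.Adj x z) :
    ∃ v, A.Before (R.trap v) ∧ R.graph.Adj (π x) v := by
  by_cases hd : π z ∈ done
  · rcases h.side z hd with hl | hr | hn
    · exact ⟨π z, hz.trans hl.1, h.adj _ _ hxz⟩
    · obtain ⟨v, hv, hxv⟩ := hr.2 x hxz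
      exact ⟨v, hz.trans hv, hxv⟩
    · exact absurd hxz (hn x)
  · exact ⟨π z, by rwa [← h.unsplit z hd], h.adj _ _ hxz⟩

/-- The vertex from which a vertex of the split graph stems in the last splitting. -/
abbrev splitProj (u : W) : SplitVert u → W := splitOrigin id u

theorem adj_splitProj {u : W} {δ δs : Set W} {p q : SplitVert u}
    (h : (splitGraph H u δ δs).Adj p q) : H.Adj (splitProj u p) (splitProj u q) := by
  have key : ∀ {i} {a : W}, a ∈ derivNbrs H u δ δs i → H.Adj u a := by
    rintro (_ | _) a (h | h) <;> exact h.1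
  rcases p with a | i <;> rcases q with b | j
  · exact h
  · exact (key h).symm
  · exact key h
  · exact h.elim

theorem splitOrigin_eq (u : W) (p : SplitVert u) : splitOrigin π u p = π (splitProj u p) := by
  rcases p with a | i <;> rfl

theorem split [Finite W] (h : IsSplitRep R H π S done) {u : W} (hu : π u ∉ done)
    (hfib : ∀ w, π w = π u → w = u) {δ δs : Set W} (hδ : IsDelta H u δ δs) :
    ∃ S', IsSplitRep R (splitGraph H u δ δs) (splitOrigin π u) S' (insert (π u) done) := by
  obtain ⟨a, b, hd, hab⟩ := h.represents.exists_derivLine hδ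
  have hSu := h.unsplit u hu
  have hab' : ∀ i j, i ≠ j → (Trap.ofLine (a i) (b i)).Before (Trap.ofLine (a j) (b j)) ∨
      (Trap.ofLine (a j) (b j)).Before (Trap.ofLine (a i) (b i)) := by
    rintro (_ | _) (_ | _) hij
    · exact absurd rfl hij
    · exact hab
    · exact hab.symm
    · exact absurd rfl hij
  -- As `u` is the only vertex over `π u`, a surviving old vertex was split now only if it was split
  -- before.
  have hdone : ∀ v : {v : W // v ≠ u}, π v.1 ∈ insert (π u) done → π v.1 ∈ done := fun v hv =>
    hv.resolve_left fun e => v.2 (hfib _ e)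
  refine ⟨Sum.elim (fun v => S v.1) fun i => Trap.ofLine (a i) (b i),
    ?_, ?_, ?_, ?_, ?_, ?_, ?_⟩
  · rintro (v | i) (w | j)
    · have := h.represents v.1 w.1
      rw [Ne, ← Subtype.ext_iff, ← (Sum.inl_injective (β := Bool)).eq_iff] at this
      exact this
    · have := (hd j).mem_iff v.1 v.2
      rw [Trap.meets_comm] at this
      exact this.trans (and_iff_right Sum.inl_ne_inr).symm
    · exact ((hd i).mem_iff w.1 w.2).trans (and_iff_right Sum.inr_ne_inl).symm
    · refine ⟨fun h' => h'.elim, fun ⟨hij, hm⟩ => ?_⟩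
      exact (hab' i j fun e => hij (congrArg _ e)).elim hm.1 hm.2
  · intro p q hpq
    rw [splitOrigin_eq, splitOrigin_eq]
    exact h.adj _ _ (adj_splitProj hpq)
  · rintro (v | i) hv
    · exact h.unsplit v.1 fun h' => hv (Or.inr h')
    · exact (hv (Or.inl rfl)).elim
  · rintro (v | i) hv
    · exact h.line v.1 (hdone v hv)
    · exact ⟨_, _, rfl⟩
  · rintro (v | i) hv
    · rcases h.side v.1 (hdone v hv) with h' | h' | h'
      · refine Or.inl ⟨h'.1, fun x hx => ?_⟩
        rw [splitOrigin_eq]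
        exact h'.2 _ (adj_splitProj hx)
      · refine Or.inr (Or.inl ⟨h'.1, fun x hx => ?_⟩)
        rw [splitOrigin_eq]
        exact h'.2 _ (adj_splitProj hx)
      · exact Or.inr (Or.inr fun x hx => h' _ (adj_splitProj hx))
    · rcases (hd i).side with ⟨h1, h2⟩ | ⟨h1, h2⟩ | h1
      · refine Or.inl ⟨by rwa [hSu] at h1, ?_⟩
        rintro (x | j) hx
        · obtain ⟨z, hz, hxz⟩ := h2 x.1 hx
          exact h.exists_trap_before hz hxz
        · exact hx.elim
      · refine Or.inr (Or.inl ⟨by rwa [hSu] at h1, ?_⟩)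
        rintro (x | j) hx
        · obtain ⟨z, hz, hxz⟩ := h2 x.1 hx
          exact h.exists_before_trap hz hxz
        · exact hx.elim
      · refine Or.inr (Or.inr ?_)
        rintro (x | j) hx
        · exact (h1.le hx : x.1 ∈ (∅ : Set W))
        · exact hx.elim
  · rintro (v | i) (w | j) e
    · exact congrArg Sum.inl (Subtype.ext (h.lt_injective e))
    · exact ((hd j).fresh v.1).1 e |>.elim
    · exact ((hd i).fresh w.1).1 (Eq.symm e) |>.elim
    · by_contra hij
      rcases hab' i j fun e' => hij (congrArg _ e') with h' | h'
      · exact h'.1.ne e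
      · exact h'.1.ne' e
  · rintro (v | i) (w | j) e
    · exact congrArg Sum.inl (Subtype.ext (h.lb_injective e))
    · exact ((hd j).fresh v.1).2.2.1 e |>.elim
    · exact ((hd i).fresh w.1).2.2.1 (Eq.symm e) |>.elim
    · by_contra hij
      rcases hab' i j fun e' => hij (congrArg _ e') with h' | h'
      · exact h'.2.ne e
      · exact h'.2.ne' e

/-- Crossing lines of two derivatives are oriented in the same way as some lines of the trapezoids
from which they stem. -/
theorem mergedArc (h : IsSplitRep R H π S done) {v w : W} (hv : π v ∈ done) (hw : π w ∈ done)
    (hvw : H.Adj v w) (ht : (S w).lt < (S v).lt) (hb : (S v).lb < (S w).lb) :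
    R.lines.mergedArc Prod.fst (π v) (π w) := by
  have hadj := R.graph_adj.1 (h.adj _ _ hvw)
  refine ⟨hadj.1, ?_⟩
  obtain ⟨av, bv, ev⟩ := h.line v hv
  obtain ⟨aw, bw, ew⟩ := h.line w hw
  have mk : ∀ i j, R.lines.top (π w, j) < R.lines.top (π v, i) →
      R.lines.bot (π v, i) < R.lines.bot (π w, j) →
      ∃ x y : V × Bool, x.1 = π v ∧ y.1 = π w ∧ R.lines.orient x y := fun i j h1 h2 =>
    ⟨(π v, i), (π w, j), rfl, rfl, R.lines.orient_iff.2 ⟨h1, h2⟩⟩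
  have hinj : ∀ i j, R.lines.top (π v, i) ≠ R.lines.top (π w, j) ∧
      R.lines.bot (π v, i) ≠ R.lines.bot (π w, j) := fun i j =>
    ⟨R.lines.top_injective.ne fun e => hadj.1 (congrArg Prod.fst e),
      R.lines.bot_injective.ne fun e => hadj.1 (congrArg Prod.fst e)⟩
  have hm₁ := hadj.2.1
  have hm₂ := hadj.2.2
  rw [ev] at ht hb
  rw [ew] at ht hb
  rcases h.side v hv with hl | hr | hn
  · obtain ⟨⟨l₁, l₂⟩, l₃⟩ := hl
    rcases h.side w hw with hl' | hr' | hn'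
    · obtain ⟨⟨r₁, r₂⟩, r₃⟩ := hl'
      obtain ⟨z, ⟨z₁, z₂⟩, hwz⟩ := l₃ w hvw.symm
      obtain ⟨y, ⟨y₁, y₂⟩, hvy⟩ := r₃ v hvw
      have m := (R.graph_adj.1 hwz).2.2
      have m' := (R.graph_adj.1 hvy).2.2
      rw [ev] at l₁ l₂ z₁ z₂
      rw [ew] at r₁ r₂ y₁ y₂
      simp only [Trap.Before, TrapezoidRep.trap, Trap.ofLine, not_and_or, not_lt] at *
      -- The left lines cross. The trapezoid of `π w` meets that of `z`, which lies left of the line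
      -- of `v`; the bottom order rules out that it reaches back below, so it does so above.
      -- Symmetrically, `π v` reaches back to `y` below.
      refine mk false false ?_ ?_
      · rcases m with m | m <;> linarith
      · rcases m' with m' | m' <;> linarith
    · obtain ⟨⟨r₁, r₂⟩, r₃⟩ := hr'
      rw [ev] at l₁ l₂
      rw [ew] at r₁ r₂
      simp only [Trap.Before, TrapezoidRep.trap, Trap.ofLine, not_and_or, not_lt] at *
      -- Here the upper side of `π w` is entirely left of that of `π v`, so the two trapezoids,
      -- being adjacent, must have the reverse overlap below; distinct endpoints make it strict.
      refine mk false true (by linarith) (lt_of_le_of_ne ?_ (hinj _ _).2)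
      rcases hm₂ with m | m <;> linarith
    · exact absurd hvw (hn' v)
  · obtain ⟨⟨l₁, l₂⟩, l₃⟩ := hr
    rcases h.side w hw with hl' | hr' | hn'
    · obtain ⟨⟨r₁, r₂⟩, r₃⟩ := hl'
      rw [ev] at l₁ l₂
      rw [ew] at r₁ r₂
      simp only [Trap.Before, TrapezoidRep.trap, Trap.ofLine, not_and_or, not_lt] at *
      refine mk true false (lt_of_le_of_ne ?_ (hinj _ _).1.symm) (by linarith)
      rcases hm₁ with m | m <;> linarith
    · obtain ⟨⟨r₁, r₂⟩, r₃⟩ := hr'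
      obtain ⟨z, ⟨z₁, z₂⟩, hwz⟩ := l₃ w hvw.symm
      obtain ⟨y, ⟨y₁, y₂⟩, hvy⟩ := r₃ v hvw
      have m := (R.graph_adj.1 hwz).2.1
      have m' := (R.graph_adj.1 hvy).2.1
      rw [ev] at l₁ l₂ z₁ z₂
      rw [ew] at r₁ r₂ y₁ y₂
      simp only [Trap.Before, TrapezoidRep.trap, Trap.ofLine, not_and_or, not_lt] at *
      refine mk true true ?_ ?_
      · rcases m' with m' | m' <;> linarith
      · rcases m with m | m <;> linarith
    · exact absurd hvw (hn' v)
  · exact absurd hvw.symm (hn w)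

/-- The derivatives form a permutation graph, with a representation all of whose arcs are arcs of
the trapezoid representation. -/
theorem exists_permRep {k : ℕ} {x : Fin k → V} (h : IsSplitRep R H π S (Set.range x)) :
    ∃ P : PermRep (FinalVert x π), P.graph = finalGraph x H π ∧
      ∀ i j, P.mergedArc (derivativeOf x π) i j → R.lines.mergedArc Prod.fst i.1 j.1 := by
  let P : PermRep (FinalVert x π) :=
    ⟨fun w => (S w.1).lt, fun w => (S w.1).lb, h.lt_injective.comp Subtype.val_injective,
      h.lb_injective.comp Subtype.val_injective⟩
  have hP : P.graph = finalGraph x H π := by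
    ext v w
    have hl : ∀ w : FinalVert x π, Trap.ofLine (P.top w) (P.bot w) = S w.1 := by
      intro w
      obtain ⟨a, b, e⟩ := h.line w.1 w.2
      change Trap.ofLine (S w.1).lt (S w.1).lb = _
      rw [e]
      rfl
    rw [P.graph_adj, hl, hl, Ne, Subtype.ext_iff]
    exact (h.represents v.1 w.1).symm
  refine ⟨P, hP, ?_⟩
  rintro i j ⟨-, v, w, rfl, rfl, ho⟩
  have hvw : H.Adj v.1 w.1 := by
    have := ho.1
    rw [hP] at this
    exact this
  obtain ⟨ht, hb⟩ := P.orient_iff.1 ho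
  exact h.mergedArc v.2 w.2 hvw ht hb

end IsSplitRep
end SplitU

namespace SplitU

variable {V : Type u}

/-! ### Runs of the algorithm -/

/-- The vertices split in the first `i` steps. -/
def splitSet {k : ℕ} (x : Fin k → V) (i : ℕ) : Set V := {v | ∃ j : Fin k, j.1 < i ∧ x j = v}

theorem splitSet_zero {k : ℕ} (x : Fin k → V) : splitSet x 0 = ∅ := by
  ext v
  simp [splitSet]

theorem splitSet_succ {k : ℕ} (x : Fin k → V) (i : Fin k) :
    splitSet x (i + 1) = insert (x i) (splitSet x i) := by
  ext v
  constructor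
  · rintro ⟨j, hj, rfl⟩
    rcases Nat.lt_succ_iff_lt_or_eq.1 hj with h | h
    · exact Or.inr ⟨j, h, rfl⟩
    · exact Or.inl (congrArg x (Fin.ext h))
  · rintro (rfl | ⟨j, hj, rfl⟩)
    · exact ⟨i, Nat.lt_succ_self _, rfl⟩
    · exact ⟨j, Nat.lt_succ_of_lt hj, rfl⟩

theorem splitSet_last {k : ℕ} (x : Fin k → V) : splitSet x k = Set.range x := by
  ext v
  simp [splitSet]

theorem notMem_splitSet {k : ℕ} {x : Fin k → V} (hx : Function.Injective x) (i : Fin k) :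
    x i ∉ splitSet x i := by
  rintro ⟨j, hj, e⟩
  rw [hx e] at hj
  exact lt_irrefl _ hj

open Classical in
theorem ncard_fiber_splitOrigin {W : Type u} {π : W → V} {w : W}
    (hw : π ⁻¹' {π w} = {w}) (v : V) :
    ((splitOrigin π w) ⁻¹' {v}).ncard = if v = π w then 2 else (π ⁻¹' {v}).ncard := by
  split_ifs with h
  · have : (splitOrigin π w) ⁻¹' {v} = {Sum.inr false, Sum.inr true} := by
      subst h
      ext p
      rcases p with a | i
      · have ha : π a.1 ≠ π w := fun e => a.2 (hw.le (show a.1 ∈ π ⁻¹' {π w} from e))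
        simp [splitOrigin, ha]
      · cases i <;> simp [splitOrigin]
    rw [this, Set.ncard_pair (by simp)]
  · have hv : ∀ a ∈ π ⁻¹' {v}, a ≠ w := by
      rintro a rfl rfl
      exact h rfl
    symm
    refine Set.ncard_congr (fun a ha => Sum.inl ⟨a, hv a ha⟩) (fun a ha => ha) ?_ ?_
    · intro a b _ _ e
      exact congrArg Subtype.val (Sum.inl_injective e)
    · rintro (a | i) hp
      · exact ⟨a.1, hp, rfl⟩
      · exact (h (Eq.symm hp)).elim

open Classical in
-- Distinctness of the `x i` ensures that each step splits a vertex whose fiber is still a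
-- singleton.
theorem Reaches.finite_and_ncard_fiber [Finite V] {G : SimpleGraph V} {k : ℕ} {x : Fin k → V}
    (hx : Function.Injective x) {i : ℕ} {W : Type u} {H : SimpleGraph W} {π : W → V}
    (h : Reaches G x i W H π) :
    Finite W ∧ ∀ v, (π ⁻¹' {v}).ncard = if v ∈ splitSet x i then 2 else 1 := by
  induction h with
  | init => exact ⟨inferInstance, fun v => by simp [splitSet_zero]⟩
  | step i W H π w δ δs h hw hδ ih =>
    obtain ⟨hfin, hcard⟩ := ih
    refine ⟨inferInstance, fun v => ?_⟩
    have h1 := hcard (π w)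
    rw [hw, if_neg (notMem_splitSet hx i), ← hw] at h1
    obtain ⟨w', hw'⟩ := Set.ncard_eq_one.1 h1
    have hww : π ⁻¹' {π w} = {w} := by
      rw [hw', ← show w = w' from hw'.le (show w ∈ π ⁻¹' {π w} from rfl)]
    rw [ncard_fiber_splitOrigin hww, splitSet_succ, hw]
    by_cases hv : v = x i
    · simp [hv]
    · simp [hv, hcard]

theorem Reaches.existsUnique_origin [Finite V] {G : SimpleGraph V} {k : ℕ} {x : Fin k → V}
    (hx : Function.Injective x) {i : Fin k} {W : Type u} {H : SimpleGraph W} {π : W → V}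
    (h : Reaches G x i W H π) : ∃! w, π w = x i := by
  have h1 := (h.finite_and_ncard_fiber hx).2 (x i)
  rw [if_neg (notMem_splitSet hx i)] at h1
  obtain ⟨w, hw⟩ := Set.ncard_eq_one.1 h1
  exact ⟨w, hw.ge rfl, fun w' hw' => hw.le hw'⟩

theorem Reaches.exists_isSplitRep [Finite V] (R : TrapezoidRep V) {k : ℕ} {x : Fin k → V}
    (hx : Function.Injective x) {i : ℕ} {W : Type u} {H : SimpleGraph W} {π : W → V}
    (h : Reaches R.graph x i W H π) : ∃ S, IsSplitRep R H π S (splitSet x i) := by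
  induction h with
  | init => exact ⟨R.trap, by rw [splitSet_zero]; exact isSplitRep_init R⟩
  | step i W H π w δ δs h hw hδ ih =>
    obtain ⟨S, hS⟩ := ih
    have := (h.finite_and_ncard_fiber hx).1
    rw [splitSet_succ, ← hw]
    refine hS.split ?_ (fun w' hw' => ?_) hδ
    · rw [hw]
      exact notMem_splitSet hx i
    · exact (h.existsUnique_origin hx).unique (hw'.trans hw) hw

theorem ncard_fiber_derivativeOf {k : ℕ} {x : Fin k → V} {W : Type u} {π : W → V}
    (i : Set.range x) : ((derivativeOf x π) ⁻¹' {i}).ncard = (π ⁻¹' {i.1}).ncard := by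
  refine Set.ncard_congr (fun w _ => w.1) (fun w hw => congrArg Subtype.val hw) ?_ ?_
  · intro a b _ _ e
    exact Subtype.ext e
  · intro b hb
    have hb' : π b = i.1 := hb
    exact ⟨⟨b, by rw [Set.mem_ofPred_eq, hb']; exact i.2⟩, Subtype.ext hb', rfl⟩

theorem card_finalVert {k : ℕ} {x : Fin k → V} (hx : Function.Injective x) {W : Type u} [Finite W]
    {π : W → V} (h : ∀ i : Set.range x, ((derivativeOf x π) ⁻¹' {i}).ncard = 2) :
    Nat.card (FinalVert x π) = 2 * k := by
  classical
  have := Fintype.ofFinite (FinalVert x π)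
  rw [Nat.card_congr (Equiv.sigmaFiberEquiv (derivativeOf x π)).symm, Nat.card_sigma]
  have : ∀ i : Set.range x, Nat.card {w // derivativeOf x π w = i} = 2 := fun i => by
    rw [← h i]
    rfl
  simp only [this, Finset.sum_const, Finset.card_univ, smul_eq_mul]
  rw [← Nat.card_eq_fintype_card, Nat.card_congr (Equiv.ofInjective x hx).symm, Nat.card_fin,
    mul_comm]

end SplitU

theorem theorem2p1 {V : Type u} [Finite V] (G : SimpleGraph V) (hG : IsTrapezoidGraph G)
    {k : ℕ} (x : Fin k → V) (hx : Function.Injective x)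
    (hδ : ∀ i, ∃ δ δs : Set V, SplitU.IsDelta G (x i) δ δs ∧ δs ≠ ∅) :
    -- the algorithm never gets stuck: every step can be carried out
    (∀ (i : Fin k) (W : Type u) (H : SimpleGraph W) (π : W → V),
      SplitU.Reaches G x i W H π →
        ∃ w : W, π w = x i ∧ ∃ δ δs : Set W, SplitU.IsDelta H w δ δs) ∧
    -- whatever choices are made, the returned graph is as claimed
    (∀ (W : Type u) (H : SimpleGraph W) (π : W → V),
      SplitU.Reaches G x k W H π →
        IsPermutationGraph (SplitU.finalGraph x H π) ∧
        Nat.card (SplitU.FinalVert x π) = 2 * k ∧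
        (IsAcyclicTrapezoidGraph G →
          IsAcyclicPermutationGraph (SplitU.finalGraph x H π) (SplitU.derivativeOf x π))) := by
  classical
  refine ⟨fun i W H π h => ?_, fun W H π h => ?_⟩
  · obtain ⟨R, rfl⟩ := hG
    obtain ⟨hfin, hcard⟩ := h.finite_and_ncard_fiber hx
    obtain ⟨w, hw, -⟩ := h.existsUnique_origin hx
    obtain ⟨S, hS⟩ := h.exists_isSplitRep R hx
    obtain ⟨δ, δs, hd, -⟩ := hδ i
    obtain ⟨z, hz⟩ := SplitU.components_nonempty_of_mem hd.1.1
    obtain ⟨hzu, hzu'⟩ := SplitU.not_mem_closedNbhd_of_mem hd.1.1 hz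
    -- The vertex `z` outside $N[x_i]$ in the input graph still has a copy `z'`, perhaps a
    -- derivative. Adjacency in `H` projects to adjacency in the input graph, so `z'` lies outside
    -- $N[w]$ and a component exists.
    obtain ⟨z', rfl⟩ : (π ⁻¹' {z}).Nonempty := by
      apply Set.nonempty_of_ncard_ne_zero
      rw [hcard]
      split_ifs <;> simp
    refine ⟨w, hw, SplitU.exists_isDelta (z := z') ?_ fun h' => hzu' ?_⟩
    · rintro rfl
      exact hzu hw
    · rw [← hw]
      exact hS.adj _ _ h'
  · obtain ⟨hfin, hcard⟩ := h.finite_and_ncard_fiber hx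
    have hfib : ∀ i : Set.range x, ((SplitU.derivativeOf x π) ⁻¹' {i}).ncard = 2 := fun i => by
      rw [SplitU.ncard_fiber_derivativeOf, hcard, SplitU.splitSet_last, if_pos i.2]
    have hrep : ∀ R : TrapezoidRep V, R.graph = G →
        ∃ P : PermRep (SplitU.FinalVert x π), P.graph = SplitU.finalGraph x H π ∧
          ∀ i j, P.mergedArc (SplitU.derivativeOf x π) i j →
            R.lines.mergedArc Prod.fst i.1 j.1 := by
      rintro R rfl
      obtain ⟨S, hS⟩ := h.exists_isSplitRep R hx
      rw [SplitU.splitSet_last] at hS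
      exact hS.exists_permRep
    refine ⟨?_, SplitU.card_finalVert hx hfib, ?_⟩
    · obtain ⟨R, hR⟩ := hG
      obtain ⟨P, hP, -⟩ := hrep R hR
      exact ⟨P, hP⟩
    · rintro ⟨R, hR, hacyc⟩
      obtain ⟨P, hP, harc⟩ := hrep R hR
      -- A directed cycle of derivatives maps arc by arc to one in the trapezoid representation.
      exact ⟨hfib, P, hP, fun i hi => hacyc i.1 (hi.lift Subtype.val harc)⟩
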